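/- Let $\ell^2$ be the Hilbert space of square summable complex sequences $(x_0,x_1,\dots)$, let $P_k$ be the truncation that sets all entries after time $k$ to zero, and call a bounded operator $A$ on $\ell^2$ causal if $P_kAP_k=P_kA$ for all $k\ge 0$; write $\mathcal B_c$ for the algebra of causal operators, and let $\mathcal N$ be the nest of subspaces $\{0\}$, $\ell^2$, $(I-P_k)\ell^2$ ($k\ge0$). An operator $U\in\mathcal B_c$ is inner if it is a partial isometry and $U^*U$ commutes with the orthogonal projections onto the members of $\mathcal N$; an operator $G\in\mathcal B_c$ is outer if its range projection commutes with these projections and $GN$ is dense in $N\cap G\ell^2$ for every $N\in\mathcal N$. Operators $\ell^2\to\ell^2\times\ell^2$ are written as columns, and $\ell^2\times\ell^2$ carries the norm $(\|x\|_2^2+\|y\|_2^2)^{1/2}$. Let $W,V,P\in\mathcal B_c$. Let $\Lambda_1\in\mathcal B_c$ be a spectral factor of $W^*W+V^*V$, i.e. $\Lambda_1^*\Lambda_1=W^*W+V^*V$ with $\Lambda_1^{-1}\in\mathcal B_c$, and let $\Lambda_1P=U_1G$ be an inner-outer factorization ($U_1$ inner, $G$ outer, the initial space of the partial isometry $U_1$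 being the closure of the range of $G$). Assume (A3): $G$ is invertible and $G^{-1}\in\mathcal B_c$. Put $T_1=\begin{pmatrix}W\\0\end{pmatrix}$ and $R=\begin{pmatrix}W\\V\end{pmatrix}\Lambda_1^{-1}U_1$, let $\Lambda,\Lambda^{-1}\in\mathcal B_c$ with $\Lambda^*\Lambda=R^*R$, and put $R_2=R\Lambda^{-1}$. Let $\mathcal C_1$ be the space of columns $s=\begin{pmatrix}s_1\\s_2\end{pmatrix}$ of trace class operators $s_1,s_2$ on $\ell^2$, with norm $\|s\|_{11}=\operatorname{tr}\big((s_1^*s_1+s_2^*s_2)^{1/2}\big)$, and let ${}^\perp(R_2\mathcal B_c)=\{s\in\mathcal C_1:\ \operatorname{tr}\big((R_2Q)^*s\big)=0\ \text{for all } Q\in\mathcal B_c\}$. Define $$\mu_o=\inf_{Q\in\mathcal B_c}\left\|\begin{pmatrix}W\\0\end{pmatrix}-\begin{pmatrix}W\\V\end{pmatrix}PQ\right\| .$$ Then $\mu_o=\inf_{Q\in\mathcal B_c}\|T_1-R_2Q\|$, and there exists $Q_o\in\mathcal B_c$ such that $$\mu_o=\|T_1-R_2Q_o\|=\sup\big\{|\operatorname{tr}(T_1^*s)|:\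 s\in{}^\perp(R_2\mathcal B_c),\ \|s\|_{11}\le1\big\}.$$ -/

import Mathlib

open scoped ENNReal InnerProductSpace

noncomputable section

namespace MixedSensitivity

/-- The Hilbert space of square summable complex sequences. -/
abbrev EllTwo : Type := lp (fun _ : ℕ => ℂ) 2

/-- The Hilbert space of pairs, with `‖(x, y)‖ ^ 2 = ‖x‖ ^ 2 + ‖y‖ ^ 2`. -/
abbrev EllTwoSq : Type := WithLp 2 (EllTwo × EllTwo)

/-- The bounded linear operators on `ℓ²`. -/
abbrev Op : Type := EllTwo →L[ℂ] EllTwo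

/-- The bounded linear operators from `ℓ²` to `ℓ² × ℓ²`, with the operator norm. -/
abbrev ColOp : Type := EllTwo →L[ℂ] EllTwoSq

/-- The standard basis vectors of `ℓ²`. -/
def e (i : ℕ) : EllTwo := lp.single 2 i (1 : ℂ)

/-- The column operator with blocks `B₁` (top) and `B₂` (bottom). -/
def col (B₁ B₂ : Op) : ColOp :=
  (WithLp.prodContinuousLinearEquiv 2 ℂ EllTwo EllTwo).symm.toContinuousLinearMap ∘L B₁.prod B₂

/-- The top block of a column operator. -/
def top (B : ColOp) : Op :=
  ContinuousLinearMap.fst ℂ EllTwo EllTwo ∘L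
    (WithLp.prodContinuousLinearEquiv 2 ℂ EllTwo EllTwo).toContinuousLinearMap ∘L B

/-- The bottom block of a column operator. -/
def bot (B : ColOp) : Op :=
  ContinuousLinearMap.snd ℂ EllTwo EllTwo ∘L
    (WithLp.prodContinuousLinearEquiv 2 ℂ EllTwo EllTwo).toContinuousLinearMap ∘L B

/-! ### Causal operators, inner and outer operators -/

/-- Truncation: `trunc m` keeps the coordinates `x 0, …, x (m - 1)` and sets the others to zero.
So `trunc 0 = 0`, and `trunc (k + 1)` is the projection that sets all outputs after time `k`
to zero. -/
def trunc (m : ℕ) : Op :=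
  ∑ i ∈ Finset.range m, InnerProductSpace.rankOne ℂ (e i) (e i)

theorem trunc_apply (m : ℕ) (x : EllTwo) (n : ℕ) :
    (trunc m x : EllTwo) n = if n < m then x n else 0 := by
  have h : ∀ i : ℕ, (⟪e i, x⟫_ℂ : ℂ) = x i := fun i => by simp [e, lp.inner_single_left]
  simp only [trunc, sum_apply, InnerProductSpace.rankOne_apply, h,
    lp.coeFn_sum, Finset.sum_apply, lp.coeFn_smul, Pi.smul_apply, smul_eq_mul]
  simp [e, Pi.single_apply]

/-- The complementary projection, onto the sequences supported in `{m, m + 1, …}`. The ranges of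
these projections, together with `{0}`, form the nest that defines causality. -/
def tail (m : ℕ) : Op := 1 - trunc m

/-- Causal bounded operators on `ℓ²` (lower triangular matrices). -/
def IsCausal (A : Op) : Prop :=
  ∀ m : ℕ, trunc m * A * trunc m = trunc m * A

/-- `A` is invertible in the algebra of causal operators: `A` is causal, it is invertible, and its
inverse is causal. -/
def IsCausalUnit (A : Op) : Prop :=
  IsCausal A ∧ IsUnit A ∧ IsCausal (Ring.inverse A)

/-- `U` preserves the norm of the vectors orthogonal to its null space. -/
def IsPartialIsometry (U : Op) : Prop :=
  ∀ x ∈ (LinearMap.ker U.toLinearMap)ᗮ, ‖U x‖ = ‖x‖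

/-- Inner operators in the algebra of causal operators. -/
def IsInner (U : Op) : Prop :=
  IsCausal U ∧ IsPartialIsometry U ∧ ∀ m : ℕ, Commute (star U * U) (tail m)

/-- The orthogonal projection onto the closure of the range of `A`. -/
def rangeProj (A : Op) : Op :=
  (LinearMap.range A.toLinearMap).topologicalClosure.starProjection

/-- Outer operators in the algebra of causal operators: the range projection commutes with the
nest, and `A N` is dense in `N ∩ range A` for every `N` in the nest. -/
def IsOuter (A : Op) : Prop :=
  IsCausal A ∧ (∀ m : ℕ, Commute (rangeProj A) (tail m)) ∧
    ∀ m : ℕ, Set.range (tail m) ∩ Set.range A ⊆ closure (A '' Set.range (tail m))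

/-- `A = U G` is an inner-outer factorization: `U` is inner, `G` is outer, and the initial space
of the partial isometry `U` is the closure of the range of `G`. -/
structure IsInnerOuterFactorization (A U G : Op) : Prop where
  inner : IsInner U
  outer : IsOuter G
  eq : A = U * G
  initial : star U * U = rangeProj G

/-- `L` is an (outer) spectral factor of `A`: it is invertible in the algebra of causal operators
and `A = L⋆ L`. -/
def IsSpectralFactor (L A : Op) : Prop :=
  IsCausalUnit L ∧ star L * L = A

/-! ### Trace class operators and trace duality -/

/-- The trace of an operator on `ℓ²`. -/
def tr (T : Op) : ℂ := ∑' i : ℕ, ⟪e i, T (e i)⟫_ℂ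

/-- The trace, in `[0, ∞]`, of a positive operator on `ℓ²`. -/
def posTr (A : Op) : ℝ≥0∞ := ∑' i : ℕ, ENNReal.ofReal (⟪e i, A (e i)⟫_ℂ).re

/-- The positive square root of a positive bounded operator on a complex Hilbert space. -/
def posSqrt {H : Type*} [NormedAddCommGroup H] [InnerProductSpace ℂ H] [CompleteSpace H]
    (A : H →L[ℂ] H) : H →L[ℂ] H := CFC.sqrt A

/-- The trace norm `tr ((T⋆ T) ^ (1/2))`, in `[0, ∞]`. -/
def traceNorm (T : Op) : ℝ≥0∞ := posTr (posSqrt (star T * T))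

/-- The trace class `C₁`. -/
def IsTraceClass (T : Op) : Prop := traceNorm T < ∞

/-- The column operators both of whose blocks are trace class: the predual of `ColOp`. -/
def IsTraceClassCol (B : ColOp) : Prop := IsTraceClass (top B) ∧ IsTraceClass (bot B)

/-- The norm `tr ((B₁⋆ B₁ + B₂⋆ B₂) ^ (1/2))` of the predual, in `[0, ∞]`. -/
def colNorm (B : ColOp) : ℝ≥0∞ :=
  posTr (posSqrt (star (top B) * top B + star (bot B) * bot B))

/-- The duality pairing `tr (A⋆ s)` of an operator `A` with an element `s` of the predual. -/
def pairing (A s : ColOp) : ℂ := tr (ContinuousLinearMap.adjoint A ∘L s)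

/-- The preannihilator, in the predual, of a set of operators. -/
def preannihilator (K : Set ColOp) : Set ColOp :=
  {s | IsTraceClassCol s ∧ ∀ A ∈ K, pairing A s = 0}

/-! ### The mixed sensitivity problem -/

/-- The set `R B_c` of all `R Q` with `Q` causal. -/
def causalRange (R : ColOp) : Set ColOp := {A | ∃ Q : Op, IsCausal Q ∧ A = R ∘L Q}

/-- The optimal value of the model matching problem: the infimum of `‖T - R Q‖` over all
causal `Q`. -/
def modelMatchingValue (T R : ColOp) : ℝ := ⨅ Q : {Q : Op // IsCausal Q}, ‖T - R ∘L Q.1‖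

/-- The operator `R = (W, V) Λ₁⁻¹ U₁`. -/
def R (W V L₁ U₁ : Op) : ColOp := col W V ∘L (Ring.inverse L₁ * U₁)

/-- The operator `R₂ = R Λ⁻¹`. -/
def R₂ (W V L₁ U₁ L : Op) : ColOp := R W V L₁ U₁ ∘L Ring.inverse L

end MixedSensitivity

end

open MixedSensitivity

/-! Since `Λ⋆Λ = R⋆R`, the column `R₂ = RΛ⁻¹` is an isometry, and `(W, V)P = R₂ΛG` with `ΛG` a unit
of the causal algebra. So `(W, V)P` and `R₂` generate the same set of causal multiples, and the two
infima agree (`R₂_comp`, `modelMatchingValue_comp_unit`).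

Weak duality is the trace inequality `|tr(A⋆s)| ≤ ‖A‖` on the unit ball of the predual
(`norm_pairing_le`), applied to `A = T - RQ`.

The converse truncates to the first `n` inputs. Hahn–Banach gives a functional that attains the
distance from `T` to the operators agreeing there with some `RQ`. It sees only `n` columns, so it is
the pairing with a finite rank `s` in the unit ball (`exists_pairing_eq`). Every upper bound `b` of
the dual values therefore bounds all these distances, and nearly optimal causal `Q` exist for each
`n`. As `R` is isometric, their truncations are bounded, and a weak limit is causal with `‖T - RQ‖ ≤
b` (`exists_causal_norm_sub_le`). This yields both the optimal `Q` and the absence of a gap. -/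

open Filter Topology

namespace MixedSensitivity

/-! ### Functional analysis -/

/-- Hahn–Banach: the distance to a subspace is attained by a functional that vanishes on it. -/
theorem exists_dual_eq_infDist {E : Type*} [SeminormedAddCommGroup E] [NormedSpace ℂ E]
    (S : Submodule ℂ E) (x : E) :
    ∃ f : StrongDual ℂ E, ‖f‖ ≤ 1 ∧ (∀ y ∈ S, f y = 0) ∧
      f x = ((Metric.infDist x (S : Set E) : ℝ) : ℂ) := by
  have hx : ‖(Submodule.Quotient.mk x : E ⧸ S)‖ = Metric.infDist x (S : Set E) :=
    QuotientAddGroup.norm_mk (S := S.toAddSubgroup) x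
  -- The distance is the norm of the class of `x` in `E ⧸ S`; a norming functional there is pulled
  -- back to `E`.
  obtain ⟨g, hg, hgx⟩ := exists_dual_vector'' ℂ (Submodule.Quotient.mk x : E ⧸ S)
  have hb : ∀ y : E, ‖(g.toLinearMap ∘ₗ S.mkQ) y‖ ≤ 1 * ‖y‖ := fun y =>
    (g.le_of_opNorm_le hg _).trans
      (mul_le_mul_of_nonneg_left (Submodule.Quotient.norm_mk_le S y) zero_le_one)
  refine ⟨(g.toLinearMap ∘ₗ S.mkQ).mkContinuous 1 hb,
    LinearMap.mkContinuous_norm_le _ zero_le_one _, fun y hy => ?_, ?_⟩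
  · have h0 : S.mkQ y = 0 := by simpa using hy
    simp only [LinearMap.mkContinuous_apply, LinearMap.comp_apply, h0, map_zero]
  · rw [← hx]
    exact hgx

section Hilbert

variable {H K : Type*} [NormedAddCommGroup H] [InnerProductSpace ℂ H]
  [NormedAddCommGroup K] [InnerProductSpace ℂ K]

/-- Bounded sequences of operators have limit points in the weak operator topology. -/
theorem exists_weak_limit [CompleteSpace K] (C : ℝ) (Q : ℕ → H →L[ℂ] K) (hQ : ∀ n, ‖Q n‖ ≤ C) :
    ∃ Q₀ : H →L[ℂ] K, ∀ x y,
      Tendsto (fun n => ⟪y, Q n x⟫_ℂ) (hyperfilter ℕ) (𝓝 ⟪y, Q₀ x⟫_ℂ) := by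
  have hbd : ∀ x y n, ‖⟪Q n x, y⟫_ℂ‖ ≤ C * ‖x‖ * ‖y‖ := fun x y n =>
    (norm_inner_le_norm _ _).trans
      (mul_le_mul_of_nonneg_right ((Q n).le_of_opNorm_le (hQ n) x) (norm_nonneg _))
  -- Along an ultrafilter all matrix coefficients converge at once, without passing to subsequences.
  -- The limits form a bounded sesquilinear form, which Riesz turns into `Q₀`.
  have hlim : ∀ x y, ∃ z ∈ Metric.closedBall (0 : ℂ) (C * ‖x‖ * ‖y‖),
      Tendsto (fun n => ⟪Q n x, y⟫_ℂ) (hyperfilter ℕ) (𝓝 z) := fun x y =>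
    (isCompact_closedBall (0 : ℂ) (C * ‖x‖ * ‖y‖)).ultrafilter_le_nhds'
      ((hyperfilter ℕ).map fun n => ⟪Q n x, y⟫_ℂ)
      (Filter.mem_map.2 (Filter.univ_mem' fun n => by simpa using hbd x y n))
  choose B hB hBlim using hlim
  let β : H →ₗ⋆[ℂ] K →ₗ[ℂ] ℂ := LinearMap.mk₂'ₛₗ (starRingEnd ℂ) (RingHom.id ℂ) B
    (fun x x' y => tendsto_nhds_unique (hBlim (x + x') y) (by
      simpa only [map_add, inner_add_left] using (hBlim x y).add (hBlim x' y)))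
    (fun c x y => tendsto_nhds_unique (hBlim (c • x) y) (by
      simpa only [map_smul, inner_smul_left, smul_eq_mul] using (hBlim x y).const_mul _))
    (fun x y y' => tendsto_nhds_unique (hBlim x (y + y')) (by
      simpa only [inner_add_right] using (hBlim x y).add (hBlim x y')))
    (fun c x y => tendsto_nhds_unique (hBlim x (c • y)) (by
      simpa only [inner_smul_right, smul_eq_mul, RingHom.id_apply] using
        (hBlim x y).const_mul _))
  let b : H →L⋆[ℂ] K →L[ℂ] ℂ := β.mkContinuous₂ C fun x y =>
    mem_closedBall_zero_iff.1 (hB x y)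
  let Q₀ : H →L[ℂ] K := LinearMap.mkContinuous
    { toFun := fun x => (InnerProductSpace.toDual ℂ K).symm (b x)
      map_add' := by simp
      map_smul' := fun c x => by simp [LinearIsometryEquiv.map_smulₛₗ] } ‖b‖ fun x => by simpa using b.le_opNorm x
  refine ⟨Q₀, fun x y => ?_⟩
  have h : ⟪Q₀ x, y⟫_ℂ = B x y := InnerProductSpace.toDual_symm_apply
  have h' := (hBlim x y).star
  rw [← h] at h'
  simpa only [RCLike.star_def, inner_conj_symm] using h'

/-- If `a` is positive and `‖a x‖ = ‖s x‖`, then `s` factors approximately through `a`, with a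
contractive factor. -/
theorem exists_approx_polar [CompleteSpace H] {a : H →L[ℂ] H} (ha : 0 ≤ a) {s : H →L[ℂ] K}
    (hs : ∀ x, ‖a x‖ = ‖s x‖) {ε : ℝ} (hε : 0 < ε) :
    ∃ b : H →L[ℂ] H, (∀ x, b (a x) + (ε : ℂ) • b x = x) ∧ (∀ x, a (b x) + (ε : ℂ) • b x = x) ∧
      ‖s ∘L b‖ ≤ 1 := by
  -- The factor is `b = (a + ε)⁻¹`; `s ∘L b` approximates the partial isometry of the polar
  -- decomposition of `s`.
  have hu : IsUnit (a + algebraMap ℝ (H →L[ℂ] H) ε) :=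
    (IsStrictlyPositive.nonneg_add ha (isStrictlyPositive_algebraMap hε)).isUnit
  obtain ⟨u, hu⟩ := hu
  have hm : ∀ x, (algebraMap ℝ (H →L[ℂ] H) ε) x = (ε : ℂ) • x := fun x => by
    simp [Algebra.algebraMap_eq_smul_one]
  have h1 : ∀ x, a (u⁻¹.1 x) + (ε : ℂ) • u⁻¹.1 x = x := fun x => by
    have := congrArg (fun T : H →L[ℂ] H => T x) (u.mul_inv)
    simpa [hu, hm] using this
  refine ⟨u⁻¹.1, fun x => ?_, h1, ?_⟩
  · have := congrArg (fun T : H →L[ℂ] H => T x) (u.inv_mul)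
    simpa only [hu, mul_apply_eq_comp, add_apply, hm, map_add,
      map_smul, one_apply_eq_self] using this
  · refine ContinuousLinearMap.opNorm_le_bound _ zero_le_one fun x => ?_
    rw [one_mul, ContinuousLinearMap.comp_apply, ← hs]
    set y := u⁻¹.1 x
    rw [← h1 x]
    -- Positivity of `a` makes the cross term nonnegative, hence `‖a y‖ ≤ ‖a y + ε y‖`.
    have hpos : 0 ≤ (⟪a y, y⟫_ℂ).re :=
      ((ContinuousLinearMap.nonneg_iff_isPositive a).1 ha).re_inner_nonneg_left y
    refine le_of_sq_le_sq ?_ (norm_nonneg _)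
    rw [@norm_add_sq ℂ, inner_smul_right]
    have : (0 : ℝ) ≤ RCLike.re ((ε : ℂ) * ⟪a y, y⟫_ℂ) := by
      simpa using mul_nonneg hε.le hpos
    nlinarith [sq_nonneg ‖(ε : ℂ) • y‖]

end Hilbert

/-! ### Coordinates -/

theorem inner_e (i : ℕ) (x : EllTwo) : ⟪e i, x⟫_ℂ = x i := by simp [e, lp.inner_single_left]

theorem norm_e (i : ℕ) : ‖e i‖ = 1 := by simp [e, lp.norm_single]

theorem trunc_eq_sum (m : ℕ) (x : EllTwo) : trunc m x = ∑ i ∈ Finset.range m, x i • e i := by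
  simp [trunc, sum_apply, inner_e]

theorem tsum_ofReal_norm_apply_sq (x : EllTwo) :
    ∑' i, ENNReal.ofReal (‖x i‖ ^ 2) = ENNReal.ofReal (‖x‖ ^ 2) := by
  have h := lp.hasSum_norm (p := 2) (by norm_num) x
  simp only [ENNReal.toReal_ofNat, Real.rpow_ofNat] at h
  rw [← h.tsum_eq, ENNReal.ofReal_tsum_of_nonneg (fun _ => by positivity) h.summable]

theorem norm_trunc_apply_le (m : ℕ) (x : EllTwo) : ‖trunc m x‖ ≤ ‖x‖ := by
  have h : ENNReal.ofReal (‖trunc m x‖ ^ 2) ≤ ENNReal.ofReal (‖x‖ ^ 2) := by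
    rw [← tsum_ofReal_norm_apply_sq, ← tsum_ofReal_norm_apply_sq]
    refine ENNReal.tsum_le_tsum fun i => ENNReal.ofReal_le_ofReal ?_
    rw [trunc_apply]
    split_ifs <;> simp
  exact le_of_sq_le_sq ((ENNReal.ofReal_le_ofReal_iff (by positivity)).1 h) (norm_nonneg _)

theorem tendsto_trunc (x : EllTwo) : Tendsto (fun m => trunc m x) atTop (𝓝 x) := by
  have h := (lp.hasSum_single (p := 2) (by norm_num) x).tendsto_sum_nat
  refine h.congr fun m => ?_
  rw [trunc_eq_sum]
  refine Finset.sum_congr rfl fun i _ => ?_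
  ext n
  by_cases hn : n = i <;> simp [e, hn]

/-- Both sides sum the squared moduli of all matrix entries; in `[0, ∞]` the order of summation is
free. -/
theorem tsum_norm_sq_adjoint (T : Op) :
    ∑' i, ENNReal.ofReal (‖T (e i)‖ ^ 2) =
      ∑' i, ENNReal.ofReal (‖ContinuousLinearMap.adjoint T (e i)‖ ^ 2) := by
  simp only [← tsum_ofReal_norm_apply_sq]
  rw [ENNReal.tsum_comm]
  refine tsum_congr fun i => tsum_congr fun j => ?_
  rw [← inner_e, ← inner_e, ContinuousLinearMap.adjoint_inner_right, norm_inner_symm]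

/-! ### The trace norm -/

theorem posSqrt_nonneg {H : Type*} [NormedAddCommGroup H] [InnerProductSpace ℂ H] [CompleteSpace H]
    (A : H →L[ℂ] H) : 0 ≤ posSqrt A := CFC.sqrt_nonneg A

theorem posSqrt_mul_self {H : Type*} [NormedAddCommGroup H] [InnerProductSpace ℂ H]
    [CompleteSpace H] {A : H →L[ℂ] H} (hA : 0 ≤ A) : posSqrt A * posSqrt A = A :=
  CFC.sqrt_mul_sqrt_self A hA

theorem norm_sq_eq_of_nonneg {H : Type*} [NormedAddCommGroup H] [InnerProductSpace ℂ H]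
    [CompleteSpace H] {c : H →L[ℂ] H} (hc : 0 ≤ c) (x : H) :
    ‖c x‖ ^ 2 = (⟪x, (c * c) x⟫_ℂ).re := by
  have h := ((ContinuousLinearMap.nonneg_iff_isPositive c).1 hc).isSymmetric x (c x)
  have h' : ⟪c x, c x⟫_ℂ = ⟪x, c (c x)⟫_ℂ := h
  rw [mul_apply_eq_comp, ← h']
  exact (inner_self_eq_norm_sq (𝕜 := ℂ) _).symm

theorem norm_posSqrt_sq {H : Type*} [NormedAddCommGroup H] [InnerProductSpace ℂ H]
    [CompleteSpace H] {A : H →L[ℂ] H} (hA : 0 ≤ A) (x : H) :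
    ‖posSqrt A x‖ ^ 2 = (⟪x, A x⟫_ℂ).re := by
  rw [norm_sq_eq_of_nonneg (posSqrt_nonneg A), posSqrt_mul_self hA]

theorem norm_sq_eq_top_bot (s : ColOp) (x : EllTwo) :
    ‖s x‖ ^ 2 = ‖top s x‖ ^ 2 + ‖bot s x‖ ^ 2 := by
  rw [WithLp.prod_norm_sq_eq_of_L2]
  rfl

theorem re_inner_star_mul_self (A : Op) (x : EllTwo) :
    (⟪x, (star A * A) x⟫_ℂ).re = ‖A x‖ ^ 2 := by
  rw [mul_apply_eq_comp, ContinuousLinearMap.star_eq_adjoint,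
    ContinuousLinearMap.adjoint_inner_right]
  exact inner_self_eq_norm_sq (𝕜 := ℂ) _

theorem norm_posSqrt_star_mul_self (A : Op) (x : EllTwo) :
    ‖posSqrt (star A * A) x‖ = ‖A x‖ := by
  refine (sq_eq_sq₀ (norm_nonneg _) (norm_nonneg _)).1 ?_
  rw [norm_posSqrt_sq (star_mul_self_nonneg A), re_inner_star_mul_self]

theorem norm_posSqrt_col (s : ColOp) (x : EllTwo) :
    ‖posSqrt (star (top s) * top s + star (bot s) * bot s) x‖ = ‖s x‖ := by
  refine (sq_eq_sq₀ (norm_nonneg _) (norm_nonneg _)).1 ?_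
  rw [norm_posSqrt_sq (add_nonneg (star_mul_self_nonneg _) (star_mul_self_nonneg _)),
    add_apply, inner_add_right, Complex.add_re, re_inner_star_mul_self,
    re_inner_star_mul_self, norm_sq_eq_top_bot]

theorem posTr_eq_sum {a : Op} {n : ℕ} (h : ∀ i, n ≤ i → a (e i) = 0) :
    posTr a = ∑ i ∈ Finset.range n, ENNReal.ofReal (⟪e i, a (e i)⟫_ℂ).re := by
  refine tsum_eq_sum fun i hi => ?_
  simp [h i (by simpa using hi)]

theorem isTraceClass_of_apply_e_eq_zero {A : Op} {n : ℕ} (h : ∀ i, n ≤ i → A (e i) = 0) :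
    IsTraceClass A := by
  have h' : ∀ i, n ≤ i → posSqrt (star A * A) (e i) = 0 := fun i hi => by
    rw [← norm_eq_zero, norm_posSqrt_star_mul_self, h i hi, norm_zero]
  rw [IsTraceClass, traceNorm, posTr_eq_sum h']
  exact ENNReal.sum_lt_top.2 fun _ _ => ENNReal.ofReal_lt_top

/-! ### Trace duality -/

theorem sum_le_of_tsum_ofReal_le {f : ℕ → ℝ} (hf : ∀ i, 0 ≤ f i) {r : ℝ} (hr : 0 ≤ r)
    (h : ∑' i, ENNReal.ofReal (f i) ≤ ENNReal.ofReal r) (F : Finset ℕ) : ∑ i ∈ F, f i ≤ r := by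
  rw [← ENNReal.ofReal_le_ofReal_iff hr, ENNReal.ofReal_sum_of_nonneg fun i _ => hf i]
  exact (ENNReal.sum_le_tsum F).trans h

section Duality

variable {K : Type*} [NormedAddCommGroup K] [InnerProductSpace ℂ K] [CompleteSpace K]

/-- Write `a = c²` and `s ≈ D c²` with `‖D‖ ≤ 1`. Then `⟪A e, D c² e⟫ = ⟪T e, c e⟫` for `T = c D⋆
A`, where `c` and `T` have Hilbert–Schmidt norms at most `1` and `‖A‖`; Cauchy–Schwarz concludes.
Absolute values over finite sets also give summability. -/
theorem sum_norm_inner_le {a : Op} (ha : 0 ≤ a) {s : EllTwo →L[ℂ] K} (hs : ∀ x, ‖a x‖ = ‖s x‖)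
    (htr : posTr a ≤ 1) (A : EllTwo →L[ℂ] K) (F : Finset ℕ) :
    ∑ i ∈ F, ‖⟪A (e i), s (e i)⟫_ℂ‖ ≤ ‖A‖ := by
  set c := posSqrt a with hc
  have hcc : c * c = a := posSqrt_mul_self ha
  have hcself : ∀ x y, ⟪c x, y⟫_ℂ = ⟪x, c y⟫_ℂ := fun x y =>
    ((ContinuousLinearMap.nonneg_iff_isPositive c).1 (posSqrt_nonneg a)).isSymmetric x y
  have hcadj : ContinuousLinearMap.adjoint c = c :=
    ((ContinuousLinearMap.nonneg_iff_isPositive c).1 (posSqrt_nonneg a)).isSelfAdjoint.adjoint_eq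
  have hctr : ∑' i, ENNReal.ofReal (‖c (e i)‖ ^ 2) ≤ ENNReal.ofReal 1 := by
    simpa only [hc, norm_posSqrt_sq ha, ENNReal.ofReal_one, posTr] using htr
  have key : ∀ ε : ℝ, 0 < ε →
      ∑ i ∈ F, ‖⟪A (e i), s (e i)⟫_ℂ‖ ≤ ‖A‖ + ε * (F.card * ‖A‖) := by
    intro ε hε
    obtain ⟨b, hb, -, hD⟩ := exists_approx_polar ha hs hε
    set D := s ∘L b with hDdef
    set T : Op := c ∘L ContinuousLinearMap.adjoint D ∘L A with hT
    have hTadj : ContinuousLinearMap.adjoint T = ContinuousLinearMap.adjoint A ∘L D ∘L c := by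
      simp only [hT, ContinuousLinearMap.adjoint_comp, ContinuousLinearMap.adjoint_adjoint, hcadj,
        ContinuousLinearMap.comp_assoc]
    -- In `T⋆ = A⋆ D c` the Hilbert–Schmidt factor `c` acts first, so a termwise estimate is
    -- possible.
    have hTtr : ∑' i, ENNReal.ofReal (‖T (e i)‖ ^ 2) ≤ ENNReal.ofReal (‖A‖ ^ 2) := by
      rw [tsum_norm_sq_adjoint, hTadj]
      calc ∑' i, ENNReal.ofReal (‖(ContinuousLinearMap.adjoint A ∘L D ∘L c) (e i)‖ ^ 2)
          ≤ ∑' i, ENNReal.ofReal (‖A‖ ^ 2) * ENNReal.ofReal (‖c (e i)‖ ^ 2) := by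
            refine ENNReal.tsum_le_tsum fun i => ?_
            rw [← ENNReal.ofReal_mul (by positivity), ← mul_pow]
            refine ENNReal.ofReal_le_ofReal (pow_le_pow_left₀ (norm_nonneg _) ?_ 2)
            refine ((ContinuousLinearMap.adjoint A).le_opNorm _).trans ?_
            rw [LinearIsometryEquiv.norm_map]
            refine mul_le_mul_of_nonneg_left ?_ (norm_nonneg _)
            simpa using D.le_of_opNorm_le hD (c (e i))
        _ ≤ ENNReal.ofReal (‖A‖ ^ 2) := by
            rw [ENNReal.tsum_mul_left]
            refine (mul_le_mul_right hctr _).trans_eq ?_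
            rw [ENNReal.ofReal_one, mul_one]
    have hsD : ∀ x, s x = D (c (c x)) + (ε : ℂ) • D x := fun x => by
      have h := congrArg s (hb x)
      rw [map_add, map_smul, ← hcc] at h
      exact h.symm
    -- The regularisation costs `ε ‖A‖` per index, so `ε → 0` is taken with `F` finite and fixed.
    have hterm : ∀ i, ‖⟪A (e i), s (e i)⟫_ℂ‖ ≤ ‖T (e i)‖ * ‖c (e i)‖ + ε * ‖A‖ := by
      intro i
      have h1 : ⟪A (e i), D (c (c (e i)))⟫_ℂ = ⟪T (e i), c (e i)⟫_ℂ := by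
        rw [← ContinuousLinearMap.adjoint_inner_left, ← hcself]
        rfl
      rw [hsD, inner_add_right, inner_smul_right, h1]
      refine (norm_add_le _ _).trans (add_le_add (norm_inner_le_norm _ _) ?_)
      rw [norm_mul, Complex.norm_real, Real.norm_of_nonneg hε.le]
      refine mul_le_mul_of_nonneg_left ((norm_inner_le_norm _ _).trans ?_) hε.le
      have hA : ‖A (e i)‖ ≤ ‖A‖ := by simpa [norm_e] using A.le_opNorm (e i)
      have hD' : ‖D (e i)‖ ≤ 1 := by simpa [norm_e] using D.le_of_opNorm_le hD (e i)
      simpa using mul_le_mul hA hD' (norm_nonneg _) (norm_nonneg _)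
    have hcs : ∑ i ∈ F, ‖T (e i)‖ * ‖c (e i)‖ ≤ ‖A‖ := by
      refine le_of_sq_le_sq ((Finset.sum_mul_sq_le_sq_mul_sq F _ _).trans ?_) (norm_nonneg _)
      have h1 := sum_le_of_tsum_ofReal_le (fun i => sq_nonneg ‖T (e i)‖) (sq_nonneg ‖A‖) hTtr F
      have h2 := sum_le_of_tsum_ofReal_le (fun i => sq_nonneg ‖c (e i)‖) zero_le_one hctr F
      simpa using mul_le_mul h1 h2 (Finset.sum_nonneg fun i _ => sq_nonneg _) (sq_nonneg _)
    calc ∑ i ∈ F, ‖⟪A (e i), s (e i)⟫_ℂ‖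
        ≤ ∑ i ∈ F, (‖T (e i)‖ * ‖c (e i)‖ + ε * ‖A‖) := Finset.sum_le_sum fun i _ => hterm i
      _ = ∑ i ∈ F, ‖T (e i)‖ * ‖c (e i)‖ + ε * (F.card * ‖A‖) := by
        rw [Finset.sum_add_distrib, Finset.sum_const, nsmul_eq_mul]; ring
      _ ≤ _ := by gcongr
  have hlim : Tendsto (fun ε : ℝ => ‖A‖ + ε * (F.card * ‖A‖)) (𝓝[>] 0) (𝓝 ‖A‖) := by
    have : Continuous fun ε : ℝ => ‖A‖ + ε * (F.card * ‖A‖) := by fun_prop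
    simpa using (this.tendsto 0).mono_left nhdsWithin_le_nhds
  exact ge_of_tendsto hlim (by filter_upwards [self_mem_nhdsWithin] with ε hε using key ε hε)

/-- If a functional of norm at most one is the trace pairing with a finitely supported `s`, then
the trace of the modulus of `s` is at most one. -/
theorem posTr_le_one {a : Op} (ha : 0 ≤ a) {s : EllTwo →L[ℂ] K} (hs : ∀ x, ‖a x‖ = ‖s x‖)
    {n : ℕ} (hn : ∀ i, n ≤ i → s (e i) = 0)
    (h : ∀ A : EllTwo →L[ℂ] K, ‖∑ i ∈ Finset.range n, ⟪A (e i), s (e i)⟫_ℂ‖ ≤ ‖A‖) :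
    posTr a ≤ 1 := by
  have han : ∀ i, n ≤ i → a (e i) = 0 := fun i hi => by
    rw [← norm_eq_zero, hs, hn i hi, norm_zero]
  have hpos := (ContinuousLinearMap.nonneg_iff_isPositive a).1 ha
  have hself : ∀ x y, ⟪a x, y⟫_ℂ = ⟪x, a y⟫_ℂ := fun x y => hpos.isSymmetric x y
  have hre : ∀ i ∈ Finset.range n, 0 ≤ (⟪e i, a (e i)⟫_ℂ).re := fun i _ =>
    hpos.re_inner_nonneg_right (e i)
  rw [posTr_eq_sum han, ← ENNReal.ofReal_one,
    ← ENNReal.ofReal_sum_of_nonneg hre]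
  refine ENNReal.ofReal_le_ofReal ?_
  have hpolar : ∀ x y, ⟪s x, s y⟫_ℂ = ⟪a x, a y⟫_ℂ := by
    have : ContinuousLinearMap.adjoint s ∘L s = ContinuousLinearMap.adjoint a ∘L a := by
      rw [← sub_eq_zero, ← ContinuousLinearMap.coe_inj]
      refine (inner_map_self_eq_zero _).1 fun x => ?_
      have h1 : ⟪ContinuousLinearMap.adjoint s (s x), x⟫_ℂ =
          ⟪ContinuousLinearMap.adjoint a (a x), x⟫_ℂ := by
        rw [ContinuousLinearMap.adjoint_inner_left, ContinuousLinearMap.adjoint_inner_left,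
          inner_self_eq_norm_sq_to_K, inner_self_eq_norm_sq_to_K, hs]
      simpa [inner_sub_left, sub_eq_zero] using h1
    intro x y
    rw [← ContinuousLinearMap.adjoint_inner_right, ← ContinuousLinearMap.adjoint_inner_right]
    exact congrArg (fun T : Op => ⟪x, T y⟫_ℂ) this
  have key : ∀ ε : ℝ, 0 < ε →
      ∑ i ∈ Finset.range n, (⟪e i, a (e i)⟫_ℂ).re ≤ 1 + ε * n := by
    intro ε hε
    obtain ⟨b, hb, hb', hD⟩ := exists_approx_polar ha hs hε
    -- The test operator is `A = s ∘L b`: since `a b = 1 - ε b`, its pairing with `s` recovers the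
    -- trace of `a` up to `ε` per index.
    have hterm : ∀ i, (⟪e i, a (e i)⟫_ℂ).re ≤ (⟪(s ∘L b) (e i), s (e i)⟫_ℂ).re + ε := by
      intro i
      have h1 : ⟪e i, a (e i)⟫_ℂ =
          ⟪(s ∘L b) (e i), s (e i)⟫_ℂ + (ε : ℂ) * ⟪a (b (e i)), e i⟫_ℂ := by
        rw [ContinuousLinearMap.comp_apply, hpolar, hself (b (e i)) (e i)]
        nth_rewrite 1 [← hb' (e i)]
        rw [inner_add_left, inner_smul_left, Complex.conj_ofReal]
      rw [h1, Complex.add_re]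
      gcongr
      rw [Complex.re_ofReal_mul]
      refine mul_le_of_le_one_right hε.le ((Complex.re_le_norm _).trans ?_)
      refine (norm_inner_le_norm _ _).trans ?_
      rw [norm_e, mul_one, hs]
      simpa [norm_e] using (s ∘L b).le_of_opNorm_le hD (e i)
    calc ∑ i ∈ Finset.range n, (⟪e i, a (e i)⟫_ℂ).re
        ≤ ∑ i ∈ Finset.range n, ((⟪(s ∘L b) (e i), s (e i)⟫_ℂ).re + ε) :=
          Finset.sum_le_sum fun i _ => hterm i
      _ = (∑ i ∈ Finset.range n, ⟪(s ∘L b) (e i), s (e i)⟫_ℂ).re + ε * n := by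
        rw [Finset.sum_add_distrib, Finset.sum_const, nsmul_eq_mul, Complex.re_sum,
          Finset.card_range, mul_comm]
      _ ≤ _ := by
        gcongr
        exact (Complex.re_le_norm _).trans ((h _).trans hD)
  have hlim : Tendsto (fun ε : ℝ => 1 + ε * (n : ℝ)) (𝓝[>] 0) (𝓝 1) := by
    have : Continuous fun ε : ℝ => 1 + ε * (n : ℝ) := by fun_prop
    simpa using (this.tendsto 0).mono_left nhdsWithin_le_nhds
  exact ge_of_tendsto hlim (by filter_upwards [self_mem_nhdsWithin] with ε hε using key ε hε)

end Duality

theorem pairing_eq_tsum (A s : ColOp) : pairing A s = ∑' i, ⟪A (e i), s (e i)⟫_ℂ :=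
  tsum_congr fun i => ContinuousLinearMap.adjoint_inner_right A (e i) (s (e i))

theorem summable_norm_inner {s : ColOp} (hs : colNorm s ≤ 1) (A : ColOp) :
    Summable fun i => ‖⟪A (e i), s (e i)⟫_ℂ‖ :=
  summable_of_sum_le (fun _ => norm_nonneg _)
    (sum_norm_inner_le (posSqrt_nonneg _) (norm_posSqrt_col s) hs A)

theorem norm_pairing_le {s : ColOp} (hs : colNorm s ≤ 1) (A : ColOp) : ‖pairing A s‖ ≤ ‖A‖ := by
  rw [pairing_eq_tsum]
  exact (norm_tsum_le_tsum_norm (summable_norm_inner hs A)).trans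
    (Real.tsum_le_of_sum_le (fun _ => norm_nonneg _)
      (sum_norm_inner_le (posSqrt_nonneg _) (norm_posSqrt_col s) hs A))

theorem pairing_sub {s : ColOp} (hs : colNorm s ≤ 1) (A B : ColOp) :
    pairing (A - B) s = pairing A s - pairing B s := by
  simp only [pairing_eq_tsum]
  rw [← (summable_norm_inner hs A).of_norm.tsum_sub (summable_norm_inner hs B).of_norm]
  simp only [sub_apply, inner_sub_left]

/-- A functional of norm at most one on the column operators that depends only on finitely many
columns is the trace pairing with an element of the unit ball of the predual. -/
theorem exists_pairing_eq {f : StrongDual ℂ ColOp} (hf : ‖f‖ ≤ 1) {n : ℕ}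
    (hfn : ∀ A : ColOp, A ∘L trunc n = 0 → f A = 0) :
    ∃ s : ColOp, IsTraceClassCol s ∧ colNorm s ≤ 1 ∧ ∀ A, pairing A s = star (f A) := by
  -- The Riesz vector of `h ↦ f (h ⊗ e i)` is the `i`-th column of `s`. The pairing is conjugate
  -- linear in `A`, whence the `star` in the conclusion.
  let φ : ℕ → StrongDual ℂ EllTwoSq := fun i =>
    f ∘L (ContinuousLinearMap.smulRightL ℂ EllTwo EllTwoSq (innerSL ℂ (e i)))
  have hφ : ∀ i h, φ i h = f (InnerProductSpace.rankOne ℂ h (e i)) := fun i h => rfl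
  let s : ColOp := ∑ i ∈ Finset.range n,
    InnerProductSpace.rankOne ℂ ((InnerProductSpace.toDual ℂ EllTwoSq).symm (φ i)) (e i)
  have hse : ∀ j, s (e j) =
      if j < n then (InnerProductSpace.toDual ℂ EllTwoSq).symm (φ j) else 0 := by
    intro j
    have : ∀ i, (e j : EllTwo) i = if i = j then (1 : ℂ) else 0 := fun i => by
      simp [e, Pi.single_apply]
    simp [s, sum_apply, inner_e, this]
  have hs0 : ∀ j, n ≤ j → s (e j) = 0 := fun j hj => by rw [hse, if_neg (by omega)]
  have hfA : ∀ A : ColOp, f A = ∑ i ∈ Finset.range n, ⟪s (e i), A (e i)⟫_ℂ := by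
    intro A
    have h1 : f A = f (A ∘L trunc n) := by
      rw [← sub_eq_zero, ← map_sub]
      refine hfn _ ?_
      ext1 x
      have : trunc n (trunc n x) = trunc n x := by
        ext i; simp only [trunc_apply]; split_ifs <;> rfl
      simp [this]
    have h2 : A ∘L trunc n =
        ∑ i ∈ Finset.range n, InnerProductSpace.rankOne ℂ (A (e i)) (e i) := by
      ext1 x
      simp [trunc_eq_sum, sum_apply, inner_e]
    rw [h1, h2, map_sum]
    refine Finset.sum_congr rfl fun i hi => ?_
    rw [hse, if_pos (by simpa using hi), InnerProductSpace.toDual_symm_apply, hφ]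
  have hsum : ∀ A : ColOp, ∑ i ∈ Finset.range n, ⟪A (e i), s (e i)⟫_ℂ = star (f A) := by
    intro A
    rw [hfA, star_sum]
    exact Finset.sum_congr rfl fun i _ => (inner_conj_symm _ _).symm
  refine ⟨s, ⟨isTraceClass_of_apply_e_eq_zero (n := n) fun i hi => ?_,
    isTraceClass_of_apply_e_eq_zero (n := n) fun i hi => ?_⟩, ?_, fun A => ?_⟩
  · simp [top, hs0 i hi]
  · simp [bot, hs0 i hi]
  · refine posTr_le_one (posSqrt_nonneg _) (norm_posSqrt_col s) hs0 fun A => ?_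
    rw [hsum, norm_star]
    simpa using f.le_of_opNorm_le hf A
  · rw [pairing_eq_tsum, ← hsum]
    exact tsum_eq_sum fun i hi => by rw [hs0 i (by simpa using hi), inner_zero_right]

/-! ### Causal operators -/

theorem IsCausal.mul {A B : Op} (hA : IsCausal A) (hB : IsCausal B) : IsCausal (A * B) := by
  intro m
  rw [← mul_assoc, ← hA m, mul_assoc, mul_assoc, ← mul_assoc (trunc m) B, hB m]
  simp only [mul_assoc]

theorem isCausal_zero : IsCausal 0 := fun m => by simp

theorem IsCausal.add {A B : Op} (hA : IsCausal A) (hB : IsCausal B) : IsCausal (A + B) := by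
  intro m
  rw [mul_add, add_mul, hA m, hB m]

theorem IsCausal.smul {A : Op} (c : ℂ) (hA : IsCausal A) : IsCausal (c • A) := by
  intro m
  rw [mul_smul_comm, smul_mul_assoc, hA m]

theorem trunc_trunc (m n : ℕ) (x : EllTwo) : trunc m (trunc n x) = trunc (min m n) x := by
  ext i
  simp only [trunc_apply, lt_min_iff, ite_and]

theorem isCausal_trunc (n : ℕ) : IsCausal (trunc n) := by
  intro m
  ext1 x
  simp only [mul_apply_eq_comp, trunc_trunc]
  congr 2
  omega

theorem IsCausalUnit.inverse_mul {A : Op} (h : IsCausalUnit A) : Ring.inverse A * A = 1 :=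
  Ring.inverse_mul_cancel A h.2.1

theorem IsCausalUnit.mul_inverse {A : Op} (h : IsCausalUnit A) : A * Ring.inverse A = 1 :=
  Ring.mul_inverse_cancel A h.2.1

theorem bddBelow_norm_sub (T R : ColOp) :
    BddBelow (Set.range fun Q : {Q : Op // IsCausal Q} => ‖T - R ∘L Q.1‖) :=
  ⟨0, by rintro _ ⟨Q, rfl⟩; exact norm_nonneg _⟩

theorem modelMatchingValue_le (T R : ColOp) {Q : Op} (hQ : IsCausal Q) :
    modelMatchingValue T R ≤ ‖T - R ∘L Q‖ :=
  ciInf_le (bddBelow_norm_sub T R) ⟨Q, hQ⟩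

instance : Nonempty {Q : Op // IsCausal Q} := ⟨⟨0, isCausal_zero⟩⟩

theorem le_modelMatchingValue {T R : ColOp} {b : ℝ}
    (h : ∀ Q, IsCausal Q → b ≤ ‖T - R ∘L Q‖) : b ≤ modelMatchingValue T R :=
  le_ciInf fun Q => h Q.1 Q.2

theorem modelMatchingValue_comp_le (T R : ColOp) {A : Op} (hA : IsCausal A) :
    modelMatchingValue T R ≤ modelMatchingValue T (R ∘L A) :=
  by
  refine le_modelMatchingValue fun Q hQ => ?_
  rw [ContinuousLinearMap.comp_assoc]
  exact modelMatchingValue_le T R (hA.mul hQ)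

/-- The model matching value does not change if `R` is multiplied by a unit of the algebra of
causal operators. -/
theorem modelMatchingValue_comp_unit (T R : ColOp) {A : Op} (hA : IsCausalUnit A) :
    modelMatchingValue T (R ∘L A) = modelMatchingValue T R := by
  refine le_antisymm ?_ (modelMatchingValue_comp_le T R hA.1)
  have h := modelMatchingValue_comp_le T (R ∘L A) hA.2.2
  have h1 : (R ∘L A) ∘L Ring.inverse A = R := by
    rw [ContinuousLinearMap.comp_assoc]
    exact congrArg (R ∘L ·) hA.mul_inverse
  rwa [h1] at h

/-! ### Duality for the model matching problem -/

/-- Compactness: approximate solutions on each finite set of columns yield a solution. -/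
theorem exists_causal_norm_sub_le {T R : ColOp} (hR : ∀ x, ‖R x‖ = ‖x‖) {b : ℝ}
    (h : ∀ n : ℕ, ∀ ε > 0, ∃ Q, IsCausal Q ∧ ‖(T - R ∘L Q) ∘L trunc n‖ ≤ b + ε) :
    ∃ Q, IsCausal Q ∧ ‖T - R ∘L Q‖ ≤ b := by
  choose Q' hQ'c hQ' using fun n : ℕ => h n (1 / ((n : ℝ) + 1)) (by positivity)
  -- `Q' n` is controlled only on the first `n` inputs. Truncating keeps it causal and, as `R` is
  -- isometric, makes the sequence uniformly bounded.
  let Q : ℕ → Op := fun n => Q' n * trunc n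
  have hQc : ∀ n, IsCausal (Q n) := fun n => (hQ'c n).mul (isCausal_trunc n)
  have hTQ : ∀ n x, ‖T (trunc n x) - R (Q n x)‖ ≤ (b + 1 / ((n : ℝ) + 1)) * ‖x‖ := fun n x =>
    ((T - R ∘L Q' n) ∘L trunc n).le_of_opNorm_le (hQ' n) x
  have hb1 : ∀ n : ℕ, b + 1 / ((n : ℝ) + 1) ≤ |b| + 1 := fun n => by
    have : 1 / ((n : ℝ) + 1) ≤ 1 := by
      rw [div_le_one (by positivity)]; linarith [n.cast_nonneg (α := ℝ)]
    linarith [le_abs_self b]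
  have hQbd : ∀ n, ‖Q n‖ ≤ |b| + 1 + ‖T‖ := fun n => by
    refine ContinuousLinearMap.opNorm_le_bound _ (by positivity) fun x => ?_
    rw [← hR (Q n x), add_mul]
    have h1 := (hTQ n x).trans (mul_le_mul_of_nonneg_right (hb1 n) (norm_nonneg x))
    have h2 : ‖T (trunc n x)‖ ≤ ‖T‖ * ‖x‖ :=
      (T.le_opNorm _).trans
        (mul_le_mul_of_nonneg_left (norm_trunc_apply_le n x) (norm_nonneg _))
    have h3 := norm_sub_norm_le (R (Q n x)) (T (trunc n x))
    rw [norm_sub_rev] at h3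
    linarith
  obtain ⟨Q₀, hQ₀⟩ := exists_weak_limit _ Q hQbd
  have hb : 0 ≤ b := by
    refine ge_of_tendsto' (f := fun n : ℕ => b + 1 / ((n : ℝ) + 1)) (x := atTop) ?_
      fun n => (norm_nonneg _).trans (hQ' n)
    simpa using tendsto_const_nhds.add (tendsto_one_div_add_atTop_nhds_zero_nat (𝕜 := ℝ))
  refine ⟨Q₀, fun m => ?_, ContinuousLinearMap.opNorm_le_bound _ hb fun x => ?_⟩
  -- Causality is a linear identity between matrix coefficients, so it survives weak limits.
  · ext1 x
    refine ext_inner_left ℂ fun y => ?_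
    have h1 := hQ₀ (trunc m x) (ContinuousLinearMap.adjoint (trunc m) y)
    have h2 := hQ₀ x (ContinuousLinearMap.adjoint (trunc m) y)
    simp only [ContinuousLinearMap.adjoint_inner_left] at h1 h2
    refine tendsto_nhds_unique h1 (h2.congr fun n => ?_)
    exact congrArg (fun A : Op => ⟪y, A x⟫_ℂ) (hQc n m).symm
  · have hlim : ∀ y, Tendsto (fun n => ⟪y, T (trunc n x) - R (Q n x)⟫_ℂ) (hyperfilter ℕ)
        (𝓝 ⟪y, (T - R ∘L Q₀) x⟫_ℂ) := by
      intro y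
      have h1 : Tendsto (fun n => ⟪y, T (trunc n x)⟫_ℂ) (hyperfilter ℕ) (𝓝 ⟪y, T x⟫_ℂ) :=
        ((((innerSL ℂ y).continuous.comp T.continuous).tendsto x).comp
          (tendsto_trunc x)).mono_left Nat.hyperfilter_le_atTop
      have h2 := hQ₀ x (ContinuousLinearMap.adjoint R y)
      simp only [ContinuousLinearMap.adjoint_inner_left] at h2
      simpa only [inner_sub_right, sub_apply, ContinuousLinearMap.comp_apply] using h1.sub h2
    set z := (T - R ∘L Q₀) x
    have hbd : Tendsto (fun n : ℕ => ‖z‖ * ((b + 1 / ((n : ℝ) + 1)) * ‖x‖)) (hyperfilter ℕ)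
        (𝓝 (‖z‖ * (b * ‖x‖))) := by
      have := (tendsto_const_nhds (x := b)).add
        (tendsto_one_div_add_atTop_nhds_zero_nat (𝕜 := ℝ))
      rw [add_zero] at this
      exact ((this.mul_const ‖x‖).const_mul ‖z‖).mono_left Nat.hyperfilter_le_atTop
    -- Weak lower semicontinuity of the norm, obtained by testing against the limit `z` itself.
    have hz := le_of_tendsto_of_tendsto' (hlim z).norm hbd fun n =>
      (norm_inner_le_norm _ _).trans (mul_le_mul_of_nonneg_left (hTQ n x) (norm_nonneg _))
    rw [inner_self_eq_norm_sq_to_K, norm_pow, RCLike.norm_ofReal, abs_norm, sq] at hz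
    rcases (norm_nonneg z).eq_or_lt with h0 | h0
    · rw [← h0]; positivity
    · exact le_of_mul_le_mul_left hz h0

/-- The column operators that agree with some `R Q` on the first `n` inputs. -/
def causalRangeOn (R : ColOp) (n : ℕ) : Submodule ℂ ColOp where
  carrier := {A | ∃ Q, IsCausal Q ∧ A ∘L trunc n = (R ∘L Q) ∘L trunc n}
  zero_mem' := ⟨0, isCausal_zero, by simp⟩
  add_mem' := by
    rintro A B ⟨Q, hQ, hA⟩ ⟨Q', hQ', hB⟩
    exact ⟨Q + Q', hQ.add hQ', by
      rw [ContinuousLinearMap.comp_add, ContinuousLinearMap.add_comp,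
        ContinuousLinearMap.add_comp, hA, hB]⟩
  smul_mem' := by
    rintro c A ⟨Q, hQ, hA⟩
    exact ⟨c • Q, hQ.smul c, by
      rw [ContinuousLinearMap.comp_smul, ContinuousLinearMap.smul_comp,
        ContinuousLinearMap.smul_comp, hA]⟩

/-- The values of the dual problem. -/
def dualValues (T R : ColOp) : Set ℝ :=
  {r | ∃ s ∈ preannihilator (causalRange R), colNorm s ≤ 1 ∧ r = ‖pairing T s‖}

theorem infDist_mem_dualValues (T R : ColOp) (n : ℕ) :
    Metric.infDist T (causalRangeOn R n : Set ColOp) ∈ dualValues T R := by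
  obtain ⟨f, hf, hf0, hfT⟩ := exists_dual_eq_infDist (causalRangeOn R n) T
  -- Taking `Q = 0` puts every operator that vanishes on the first `n` inputs into the subspace, so
  -- `f` depends on `n` columns only.
  obtain ⟨s, hs, hs1, hsf⟩ := exists_pairing_eq hf (n := n) fun A hA =>
    hf0 A ⟨0, isCausal_zero, by simpa using hA⟩
  refine ⟨s, ⟨hs, ?_⟩, hs1, ?_⟩
  · rintro _ ⟨Q, hQ, rfl⟩
    rw [hsf, hf0 _ ⟨Q, hQ, rfl⟩, star_zero]
  · rw [hsf, norm_star, hfT, Complex.norm_real, Real.norm_of_nonneg Metric.infDist_nonneg]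

theorem exists_norm_sub_le_of_mem_upperBounds {T R : ColOp} (hR : ∀ x, ‖R x‖ = ‖x‖) {b : ℝ}
    (hb : b ∈ upperBounds (dualValues T R)) : ∃ Q, IsCausal Q ∧ ‖T - R ∘L Q‖ ≤ b := by
  refine exists_causal_norm_sub_le hR fun n ε hε => ?_
  have hlt : Metric.infDist T (causalRangeOn R n : Set ColOp) < b + ε :=
    (hb (infDist_mem_dualValues T R n)).trans_lt (by linarith)
  obtain ⟨A, ⟨Q, hQ, hA⟩, hTA⟩ :=
    (Metric.infDist_lt_iff ⟨0, (causalRangeOn R n).zero_mem⟩).1 hlt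
  refine ⟨Q, hQ, ?_⟩
  have h1 : (T - R ∘L Q) ∘L trunc n = (T - A) ∘L trunc n := by
    rw [ContinuousLinearMap.sub_comp, ContinuousLinearMap.sub_comp, hA]
  have h2 : ‖trunc n‖ ≤ 1 := ContinuousLinearMap.opNorm_le_bound _ zero_le_one fun x => by
    simpa using norm_trunc_apply_le n x
  rw [h1]
  rw [dist_eq_norm] at hTA
  calc ‖(T - A) ∘L trunc n‖ ≤ ‖T - A‖ * ‖trunc n‖ := ContinuousLinearMap.opNorm_comp_le _ _
    _ ≤ ‖T - A‖ * 1 := mul_le_mul_of_nonneg_left h2 (norm_nonneg _)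
    _ ≤ b + ε := by linarith

/-- Weak duality: `s` annihilates `R Q`, so `T` may be replaced by `T - R Q` in the pairing. -/
theorem modelMatchingValue_mem_upperBounds (T R : ColOp) :
    modelMatchingValue T R ∈ upperBounds (dualValues T R) := by
  rintro _ ⟨s, ⟨-, hs⟩, hs1, rfl⟩
  refine le_modelMatchingValue fun Q hQ => ?_
  have h := norm_pairing_le hs1 (T - R ∘L Q)
  rwa [pairing_sub hs1, hs _ ⟨Q, hQ, rfl⟩, sub_zero] at h

/-- If `R` is an isometry, the model matching problem has a solution. -/
theorem exists_eq_modelMatchingValue (T : ColOp) {R : ColOp} (hR : ∀ x, ‖R x‖ = ‖x‖) :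
    ∃ Q, IsCausal Q ∧ modelMatchingValue T R = ‖T - R ∘L Q‖ := by
  obtain ⟨Q, hQ, h⟩ :=
    exists_norm_sub_le_of_mem_upperBounds hR (modelMatchingValue_mem_upperBounds T R)
  exact ⟨Q, hQ, le_antisymm (modelMatchingValue_le T R hQ) h⟩

/-- If `R` is an isometry, there is no duality gap. -/
theorem isLUB_dualValues (T : ColOp) {R : ColOp} (hR : ∀ x, ‖R x‖ = ‖x‖) :
    IsLUB (dualValues T R) (modelMatchingValue T R) := by
  refine ⟨modelMatchingValue_mem_upperBounds T R, fun b hb => ?_⟩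
  obtain ⟨Q, hQ, h⟩ := exists_norm_sub_le_of_mem_upperBounds hR hb
  exact (modelMatchingValue_le T R hQ).trans h

/-! ### Reduction of the mixed sensitivity problem to an isometric `R₂` -/

theorem norm_comp_inverse_apply {R : ColOp} {L : Op}
    (hL : IsSpectralFactor L (ContinuousLinearMap.adjoint R ∘L R)) (x : EllTwo) :
    ‖(R ∘L Ring.inverse L) x‖ = ‖x‖ := by
  have h : ∀ y, ‖R y‖ = ‖L y‖ := fun y => by
    refine (sq_eq_sq₀ (norm_nonneg _) (norm_nonneg _)).1 ?_
    rw [← re_inner_star_mul_self, hL.2, ContinuousLinearMap.comp_apply,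
      ContinuousLinearMap.adjoint_inner_right]
    exact (inner_self_eq_norm_sq (𝕜 := ℂ) _).symm
  rw [ContinuousLinearMap.comp_apply, h, ← mul_apply_eq_comp, hL.1.mul_inverse, one_apply_eq_self]

/-- Cancelling `Λ` leaves `Λ₁⁻¹U₁G = Λ₁⁻¹Λ₁P = P`; thus `R₂` and `(W, V)P` differ by the right
factor `ΛG`. -/
theorem R₂_comp (W V P L₁ U₁ G L : Op) (hL₁ : IsCausalUnit L₁) (hUG : L₁ * P = U₁ * G)
    (hL : IsCausalUnit L) : (R₂ W V L₁ U₁ L ∘L L) ∘L G = col W V ∘L P := by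
  have h : Ring.inverse L₁ * U₁ * (Ring.inverse L * L) * G = P := by
    rw [hL.inverse_mul, mul_one, mul_assoc, ← hUG, ← mul_assoc, hL₁.inverse_mul, one_mul]
  exact congrArg (col W V ∘L ·) h

end MixedSensitivity

/-- `W`, `V` are the weights and `P` is the plant; `L₁` (that is, `Λ₁`) is a spectral factor of
`W⋆ W + V⋆ V`, `U₁ G` is the inner-outer factorization of `Λ₁ P`, `hA3` is the assumption that
`G` is invertible in the algebra of causal operators, and `L` (that is, `Λ`) is a spectral factor of
`R⋆ R`. -/
theorem lemma3 (W V P L₁ U₁ G L : Op)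
    (hW : IsCausal W) (hV : IsCausal V) (hP : IsCausal P)
    (hL₁ : IsSpectralFactor L₁ (star W * W + star V * V))
    (hUG : IsInnerOuterFactorization (L₁ * P) U₁ G)
    (hA3 : IsCausalUnit G)
    (hL : IsSpectralFactor L
      (ContinuousLinearMap.adjoint (R W V L₁ U₁) ∘L R W V L₁ U₁)) :
    modelMatchingValue (col W 0) (col W V ∘L P)
        = modelMatchingValue (col W 0) (R₂ W V L₁ U₁ L) ∧
      (∃ Q₀ : Op, IsCausal Q₀ ∧
        modelMatchingValue (col W 0) (R₂ W V L₁ U₁ L)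
          = ‖col W 0 - R₂ W V L₁ U₁ L ∘L Q₀‖) ∧
      IsLUB {r : ℝ | ∃ s ∈ preannihilator (causalRange (R₂ W V L₁ U₁ L)),
          colNorm s ≤ 1 ∧ r = ‖pairing (col W 0) s‖}
        (modelMatchingValue (col W 0) (R₂ W V L₁ U₁ L)) := by
  have hR₂ : ∀ x, ‖R₂ W V L₁ U₁ L x‖ = ‖x‖ := norm_comp_inverse_apply hL
  refine ⟨?_, exists_eq_modelMatchingValue _ hR₂, isLUB_dualValues _ hR₂⟩
  rw [← R₂_comp W V P L₁ U₁ G L hL₁.1 hUG.eq hL.1, modelMatchingValue_comp_unit _ _ hA3,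
    modelMatchingValue_comp_unit _ _ hL.1]
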